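/- Let $\Sigma=\{1,2,3,4,5,6\}$, let $\Sigma^*$ be the set of finite words over $\Sigma$, regarded as the $6$-regular rooted tree (the root is the empty word, and $v$ is adjacent to $vx$ for $v\in\Sigma^*$, $x\in\Sigma$), and let $\partial\Sigma^*=\Sigma^\omega$ be its boundary, i.e. the space of infinite paths without backtracking that start at the root, with the topology generated by the cylinder sets. Let $U$ be the universal Grigorchuk group, realized as the group of automorphisms of the rooted tree $\Sigma^*$ generated by the states $a,b,c,d$ of the automaton with the wreath recursion $$a=(1,1,1,1,1,1)(14)(25)(36),\quad b=(a,a,1,b,b,b),\quad c=(a,1,a,c,c,c),\quad d=(1,a,a,d,d,d),$$ where $1$ denotes the trivial state, acting as the identity. That is, $a$ applies the permutation $(14)(25)(36)$ to the first letter of a word and fixes all the other letters, and for $q\in\{b,c,d\}$ with $q=(q_1,\dots,q_6)$ one has $q(xw)=x\,q_x(w)$ for $x\in\Sigma$, $w\in\Sigma^*$. Put $\Sigma_1=\{1,4\}$, $\Sigma_2=\{2,5\}$, $\Sigma_3=\{3,6\}$. Then: (i) For every $n\ge 0$, the orbits of $U$ on the $n$-th level $\Sigma^n$ of $\Sigma^*$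 are exactly the products $\Sigma_{i_1}\Sigma_{i_2}\cdots\Sigma_{i_n}$ with $i_1,\dots,i_n\in\{1,2,3\}$. (ii) The orbit tree $T_U$, whose vertices are the orbits of $U$ on the vertices of $\Sigma^*$ and in which two orbits are adjacent if and only if they contain adjacent vertices, its root being the orbit of the empty word, is isomorphic as a rooted tree to the $3$-regular rooted tree. (iii) The space $\mathcal M^e_U$ of ergodic $U$-invariant Borel probability measures on $\partial\Sigma^*$, with the topology of weak convergence, is homeomorphic to the Cantor set. Here an invariant probability measure $\mu$ is called ergodic if $\mu(A)\in\{0,1\}$ for every $U$-invariant Borel set $A$. -/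

import Mathlib

open MeasureTheory

namespace RootedTreeAction

/-! ### Rooted trees, their automorphisms and their boundaries -/

section Trees

/-- The `d`-regular rooted tree over an alphabet `S` with `d` letters: its vertices are the finite
words over `S`, and `v` is adjacent to `vx` for every letter `x`. The root is the empty word. -/
def wordTree (S : Type*) : SimpleGraph (List S) where
  Adj u v := (∃ x, v = u ++ [x]) ∨ (∃ x, u = v ++ [x])
  symm := ⟨fun _ _ h => h.symm⟩
  loopless := ⟨by
    rintro u (⟨x, h⟩ | ⟨x, h⟩) <;> simpa using congrArg List.length h⟩

variable {V : Type*}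

/-- The group of automorphisms of the graph `T` that fix the root `r`. It acts on the vertices by
evaluation. -/
abbrev rootedAut (T : SimpleGraph V) (r : V) : Subgroup (T ≃g T) :=
  MulAction.stabilizer (T ≃g T) r

/-- The boundary of the tree `T` with root `r`: the infinite paths in `T` that start
at the root and do not backtrack. -/
@[ext]
structure Boundary (T : SimpleGraph V) (r : V) where
  /-- The `n`-th vertex of the path. -/
  vertex : ℕ → V
  vertex_zero : vertex 0 = r
  adj : ∀ n, T.Adj (vertex n) (vertex (n + 1))
  no_backtrack : ∀ n, vertex (n + 2) ≠ vertex n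

/-- The topology of the boundary: it is generated by the cylinder sets `{ξ | ξ.vertex n = v}`,
that is, it is induced from the product of discrete topologies. -/
instance boundaryTopology (T : SimpleGraph V) (r : V) : TopologicalSpace (Boundary T r) :=
  TopologicalSpace.induced Boundary.vertex (@Pi.topologicalSpace ℕ (fun _ => V) (fun _ => ⊥))

instance boundaryMeasurableSpace (T : SimpleGraph V) (r : V) :
    MeasurableSpace (Boundary T r) := borel _

instance boundaryBorelSpace (T : SimpleGraph V) (r : V) : BorelSpace (Boundary T r) := ⟨rfl⟩

/-- Rooted automorphisms act on the boundary, vertex by vertex. -/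
instance rootedAutBoundaryAction (T : SimpleGraph V) (r : V) :
    MulAction (rootedAut T r) (Boundary T r) where
  smul g ξ :=
    { vertex := fun n => g.1 (ξ.vertex n)
      vertex_zero := by rw [ξ.vertex_zero]; exact g.2
      adj := fun n => g.1.map_rel_iff.2 (ξ.adj n)
      no_backtrack := fun n h => ξ.no_backtrack n (g.1.injective h) }
  one_smul _ := rfl
  mul_smul _ _ _ := rfl

/-- The orbit tree of a group `G` acting on a rooted tree `T`: its vertices are the orbits of `G` on
the vertices of `T`, and two orbits are adjacent if and only if they contain adjacent
vertices. (For an action by rooted automorphisms an orbit lies in a single level, so that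
no orbit contains two adjacent vertices and the clause `O ≠ O'` holds automatically.) -/
def orbitTree (G : Type*) [Group G] [MulAction G V] (T : SimpleGraph V) :
    SimpleGraph (MulAction.orbitRel.Quotient G V) where
  Adj O O' := O ≠ O' ∧ ∃ u ∈ O.orbit, ∃ v ∈ O'.orbit, T.Adj u v
  symm := ⟨fun _ _ ⟨hne, u, hu, v, hv, h⟩ => ⟨hne.symm, v, hv, u, hu, h.symm⟩⟩
  loopless := ⟨fun _ h => h.1 rfl⟩

end Trees

/-- The ergodic invariant Borel probability measures of an action of `G` on `X`: the invariant
probability measures for which every `G`-invariant measurable set has measure `0` or `1`.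
As a subset of `ProbabilityMeasure X` it carries the topology of weak convergence. -/
def ergodicMeasures (G X : Type*) [Group G] [MulAction G X] [MeasurableSpace X] :
    Set (ProbabilityMeasure X) :=
  {μ | SMulInvariantMeasure G X (μ : Measure X) ∧
    ∀ A : Set X, MeasurableSet A → (∀ g : G, (fun x => g • x) ⁻¹' A = A) →
      (μ : Measure X) A = 0 ∨ (μ : Measure X) A = 1}

/-! ### Automaton groups -/

/-- An invertible Mealy automaton with states `Q` over the alphabet `S`: a transition function and
an output function, which at every state is a permutation of the alphabet. -/
structure InvertibleAutomaton (Q S : Type*) where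
  trans : Q → S → Q
  out : Q → Equiv.Perm S

namespace InvertibleAutomaton

variable {Q S : Type*} (A : InvertibleAutomaton Q S)

/-- The transformation of finite words computed by the initial automaton `A_q`. -/
def run : Q → List S → List S
  | _, [] => []
  | q, x :: w => A.out q x :: run (A.trans q x) w

/-- The inverse of `run`. -/
def runInv : Q → List S → List S
  | _, [] => []
  | q, y :: w => (A.out q).symm y :: runInv (A.trans q ((A.out q).symm y)) w

theorem runInv_run (q : Q) (w : List S) : A.runInv q (A.run q w) = w := by
  induction w generalizing q with
  | nil => rfl
  | cons x w ih => simp [run, runInv, ih]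

theorem run_runInv (q : Q) (w : List S) : A.run q (A.runInv q w) = w := by
  induction w generalizing q with
  | nil => rfl
  | cons x w ih => simp [run, runInv, ih]

theorem exists_run_append (q : Q) (u : List S) (x : S) :
    ∃ y, A.run q (u ++ [x]) = A.run q u ++ [y] := by
  induction u generalizing q with
  | nil => exact ⟨A.out q x, rfl⟩
  | cons z u ih =>
    obtain ⟨y, hy⟩ := ih (A.trans q z)
    exact ⟨y, by simp [run, hy]⟩

theorem exists_runInv_append (q : Q) (u : List S) (x : S) :
    ∃ y, A.runInv q (u ++ [x]) = A.runInv q u ++ [y] := by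
  induction u generalizing q with
  | nil => exact ⟨(A.out q).symm x, rfl⟩
  | cons z u ih =>
    obtain ⟨y, hy⟩ := ih (A.trans q ((A.out q).symm z))
    exact ⟨y, by simp [runInv, hy]⟩

theorem adj_run {q : Q} {u v : List S} (h : (wordTree S).Adj u v) :
    (wordTree S).Adj (A.run q u) (A.run q v) := by
  rcases h with ⟨x, rfl⟩ | ⟨x, rfl⟩
  · exact Or.inl (A.exists_run_append q u x)
  · exact Or.inr (A.exists_run_append q v x)

theorem adj_runInv {q : Q} {u v : List S} (h : (wordTree S).Adj u v) :
    (wordTree S).Adj (A.runInv q u) (A.runInv q v) := by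
  rcases h with ⟨x, rfl⟩ | ⟨x, rfl⟩
  · exact Or.inl (A.exists_runInv_append q u x)
  · exact Or.inr (A.exists_runInv_append q v x)

/-- The state `q` of an invertible automaton, viewed as an automorphism of the rooted tree of
finite words. -/
def stateAut (q : Q) : rootedAut (wordTree S) [] :=
  ⟨{ toFun := A.run q
     invFun := A.runInv q
     left_inv := A.runInv_run q
     right_inv := A.run_runInv q
     map_rel_iff' := ⟨fun h => by
       simpa only [Equiv.coe_fn_mk, A.runInv_run] using A.adj_runInv (q := q) h, A.adj_run⟩ }, rfl⟩

/-- The automaton group: the group of automorphisms of the rooted tree of finite words generated by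
all states of the automaton. -/
def group : Subgroup (rootedAut (wordTree S) []) :=
  Subgroup.closure (Set.range A.stateAut)

end InvertibleAutomaton

/-! ### The universal Grigorchuk group -/

/-- The states `a`, `b`, `c`, `d`, and the trivial state `one`, which acts as the identity. -/
inductive GrigorchukState
  | one | a | b | c | d

open GrigorchukState in
/-- The automaton over a 6-letter alphabet with the wreath recursion
`a = (1, 1, 1, 1, 1, 1)(14)(25)(36)`, `b = (a, a, 1, b, b, b)`, `c = (a, 1, a, c, c, c)`,
`d = (1, a, a, d, d, d)`. The letter `k` of `{1, …, 6}` is written as `k - 1 : Fin 6`. -/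
def grigorchukAutomaton : InvertibleAutomaton GrigorchukState (Fin 6) where
  trans q := match q with
    | one => ![one, one, one, one, one, one]
    | a => ![one, one, one, one, one, one]
    | b => ![a, a, one, b, b, b]
    | c => ![a, one, a, c, c, c]
    | d => ![one, a, a, d, d, d]
  out q := match q with
    | a => Equiv.swap 0 3 * Equiv.swap 1 4 * Equiv.swap 2 5
    | _ => 1

/-- The universal Grigorchuk group `U`, as an automaton group. -/
abbrev universalGrigorchukGroup : Subgroup (rootedAut (wordTree (Fin 6)) []) :=
  grigorchukAutomaton.group

/-- The alphabets `Σ₁ = {1, 4}`, `Σ₂ = {2, 5}`, `Σ₃ = {3, 6}`; indices and letters are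
shifted by one. -/
def subalphabet : Fin 3 → Set (Fin 6) := ![{0, 3}, {1, 4}, {2, 5}]

/-- The product `Σ_{i₁} ⋯ Σ_{iₙ}`: the words `x₁ ⋯ xₙ` with `xⱼ ∈ Σ_{iⱼ}` for all `j`. -/
def wordProduct (is : List (Fin 3)) : Set (List (Fin 6)) :=
  {w | List.Forall₂ (fun x i => x ∈ subalphabet i) w is}

end RootedTreeAction

namespace RootedTreeAction

/-! ### The colouring of the letters -/

/-! Colour each letter by the index of its subalphabet. Every state preserves colours letter by
letter, so the colour word is constant on orbits (`map_color_smul`). Conversely, the group is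
self-replicating: over the second letter of each subalphabet, every element of `U` occurs as the
action on the tail (`exists_section_eq`), while `a` swaps the two letters of a colour. Hence words
with equal colours lie in one orbit (`exists_smul_eq_of_map_color_eq`), and orbits correspond to
words over three colours. This gives the level orbits and the orbit tree.

For measures, invariance forces cylinders of the same colouring to have the same mass, so for each
colour sequence `ω` at most one invariant probability measure lives on the points coloured by `ω`
(`eq_of_ae_map_color_eq`). Choosing between the two letters by independent fair coins produces one
(`branchMeasure`). Uniqueness implies that it is ergodic, and ergodicity in turn forces every colour
to be almost surely constant, so there are no other ergodic measures. The map from `ω` to its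
measure is then a continuous bijection from a compact space to a Hausdorff one. Finally, sequences
over three letters are identified with binary sequences through the complete prefix code `0`, `10`,
`11`. -/

/-- The index `i` of the subalphabet containing a letter. -/
def color : Fin 6 → Fin 3 := ![0, 1, 2, 0, 1, 2]

/-- The two letters of the `i`-th subalphabet. -/
def letter (i : Fin 3) (s : Bool) : Fin 6 := bif s then ![3, 4, 5] i else ![0, 1, 2] i

theorem color_letter (i : Fin 3) (s : Bool) : color (letter i s) = i := by
  revert i s; decide

theorem eq_letter_of_color_eq {x : Fin 6} {i : Fin 3} (h : color x = i) :
    x = letter i false ∨ x = letter i true := by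
  revert x i; decide

theorem mem_subalphabet {x : Fin 6} {i : Fin 3} : x ∈ subalphabet i ↔ color x = i := by
  fin_cases i <;> fin_cases x <;> simp [subalphabet, color]

theorem wordProduct_eq (is : List (Fin 3)) :
    wordProduct is = {w | w.map color = is} := by
  ext w
  simp only [wordProduct, mem_subalphabet, Set.mem_ofPred_eq]
  rw [← List.forall₂_map_left_iff (R := fun c i => c = i), List.forall₂_eq_eq_eq]

/-! ### The orbits on the vertices -/

local notation "U" => universalGrigorchukGroup

/-- The state `q`, as an element of the universal Grigorchuk group. -/
def gen (q : GrigorchukState) : U :=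
  ⟨grigorchukAutomaton.stateAut q, Subgroup.subset_closure ⟨q, rfl⟩⟩

theorem gen_smul_cons (q : GrigorchukState) (x : Fin 6) (w : List (Fin 6)) :
    gen q • (x :: w) =
      grigorchukAutomaton.out q x :: (gen (grigorchukAutomaton.trans q x) • w) := rfl

theorem color_out (q : GrigorchukState) (x : Fin 6) :
    color (grigorchukAutomaton.out q x) = color x := by
  cases q <;> revert x <;> decide

theorem map_color_gen_smul (q : GrigorchukState) (w : List (Fin 6)) :
    (gen q • w).map color = w.map color := by
  induction w generalizing q with
  | nil => rfl
  | cons x w ih => rw [gen_smul_cons, List.map_cons, List.map_cons, ih, color_out]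

/-- Induction over the elements of the universal Grigorchuk group. -/
theorem group_induction {p : U → Prop} (gen_mem : ∀ q, p (gen q)) (one : p 1)
    (mul : ∀ g h, p g → p h → p (g * h)) (inv : ∀ g, p g → p g⁻¹) (g : U) : p g := by
  obtain ⟨g, hg⟩ := g
  refine Subgroup.closure_induction (p := fun g hg => p ⟨g, hg⟩) ?_ one
    (fun x y hx hy => mul ⟨x, hx⟩ ⟨y, hy⟩) (fun x hx => inv ⟨x, hx⟩) hg
  rintro _ ⟨q, rfl⟩
  exact gen_mem q

theorem map_color_smul (g : U) (w : List (Fin 6)) : (g • w).map color = w.map color := by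
  induction g using group_induction generalizing w with
  | gen_mem q => exact map_color_gen_smul q w
  | one => rw [one_smul]
  | mul g h hg hh => rw [mul_smul, hg, hh]
  | inv g hg => rw [← hg, smul_inv_smul]

theorem length_smul (g : U) (w : List (Fin 6)) : (g • w).length = w.length := by
  simpa using congrArg List.length (map_color_smul g w)

theorem gen_one_smul (w : List (Fin 6)) : gen .one • w = w := by
  induction w with
  | nil => rfl
  | cons x w ih =>
    have h : grigorchukAutomaton.trans .one x = .one := by fin_cases x <;> rfl
    rw [gen_smul_cons, h, ih]; rfl

theorem gen_a_smul_cons (x : Fin 6) (w : List (Fin 6)) :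
    gen .a • (x :: w) = grigorchukAutomaton.out .a x :: w := by
  have h : grigorchukAutomaton.trans .a x = .one := by fin_cases x <;> rfl
  rw [gen_smul_cons, h, gen_one_smul]

theorem gen_a_smul_letter (i : Fin 3) (s : Bool) (w : List (Fin 6)) :
    gen .a • (letter i s :: w) = letter i (!s) :: w := by
  have h : grigorchukAutomaton.out .a (letter i s) = letter i (!s) := by revert i s; decide
  rw [gen_a_smul_cons, h]

/-- For each `i` one of the states `b`, `c`, `d` has the section `a` at the first letter of the
`i`-th subalphabet. -/
theorem exists_trans_eq_a (i : Fin 3) : ∃ q, grigorchukAutomaton.trans q (letter i false) = .a ∧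
    grigorchukAutomaton.out q (letter i false) = letter i false := by
  fin_cases i
  · exact ⟨.b, rfl, rfl⟩
  · exact ⟨.b, rfl, rfl⟩
  · exact ⟨.c, rfl, rfl⟩

/-- The group is self-replicating at the second letter of every subalphabet. -/
theorem exists_section_eq (i : Fin 3) (g : U) :
    ∃ h : U, ∀ w, h • (letter i true :: w) = letter i true :: (g • w) := by
  induction g using group_induction with
  | gen_mem q =>
    by_cases hq : q = .a
    · subst hq
      obtain ⟨r, hr, hr'⟩ := exists_trans_eq_a i
      -- Conjugation by `a` moves to the first letter of the subalphabet, where `r` has section `a`,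
      -- and back.
      refine ⟨gen .a * gen r * gen .a, fun w => ?_⟩
      simp only [mul_smul]
      rw [gen_a_smul_letter, Bool.not_true, gen_smul_cons, hr, hr', gen_a_smul_letter]
      rfl
    -- Every state other than `a` fixes the letters 4, 5, 6 and is its own section there.
    · refine ⟨gen q, fun w => ?_⟩
      have h1 : grigorchukAutomaton.out q (letter i true) = letter i true := by
        cases q <;> first | exact absurd rfl hq | rfl
      have h2 : grigorchukAutomaton.trans q (letter i true) = q := by
        cases q <;> first | exact absurd rfl hq | (fin_cases i <;> rfl)
      rw [gen_smul_cons, h1, h2]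
  | one => exact ⟨1, fun w => by simp only [one_smul]⟩
  | mul g g' hg hg' =>
    obtain ⟨h, hh⟩ := hg
    obtain ⟨h', hh'⟩ := hg'
    exact ⟨h * h', fun w => by rw [mul_smul, hh', hh, mul_smul]⟩
  | inv g hg =>
    obtain ⟨h, hh⟩ := hg
    exact ⟨h⁻¹, fun w => by rw [inv_smul_eq_iff, hh, smul_inv_smul]⟩

theorem exists_smul_cons_eq (x : Fin 6) (w : List (Fin 6)) :
    ∃ g : U, g • (x :: w) = letter (color x) true :: w := by
  rcases eq_letter_of_color_eq (rfl : color x = color x) with h | h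
  · refine ⟨gen .a, ?_⟩
    conv_lhs => rw [h]
    exact gen_a_smul_letter _ _ _
  · exact ⟨1, by rw [one_smul, ← h]⟩

/-- Induction on length: bring both first letters to the second letter of their common subalphabet,
where the element matching the tails can be realized as a section. -/
theorem exists_smul_eq_of_map_color_eq {v w : List (Fin 6)} (h : v.map color = w.map color) :
    ∃ g : U, g • v = w := by
  induction v generalizing w with
  | nil =>
    obtain rfl : w = [] := by simpa using h.symm
    exact ⟨1, one_smul _ _⟩
  | cons x v ih =>
    cases w with
    | nil => simp at h
    | cons y w =>
      simp only [List.map_cons, List.cons.injEq] at h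
      obtain ⟨g, hg⟩ := ih h.2
      obtain ⟨k, hk⟩ := exists_section_eq (color x) g
      obtain ⟨p, hp⟩ := exists_smul_cons_eq x v
      obtain ⟨r, hr⟩ := exists_smul_cons_eq y w
      refine ⟨r⁻¹ * k * p, ?_⟩
      rw [mul_smul, mul_smul, hp, hk, hg, inv_smul_eq_iff, hr, h.1]

theorem mem_orbit_iff {v w : List (Fin 6)} :
    v ∈ MulAction.orbit U w ↔ v.map color = w.map color := by
  refine ⟨?_, fun h => MulAction.mem_orbit_iff.2 (exists_smul_eq_of_map_color_eq h.symm)⟩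
  rintro ⟨g, rfl⟩
  exact map_color_smul g w

theorem orbit_eq_wordProduct (w : List (Fin 6)) :
    MulAction.orbit U w = wordProduct (w.map color) := by
  ext v
  rw [wordProduct_eq, mem_orbit_iff, Set.mem_ofPred_eq]

theorem map_color_map_letter (is : List (Fin 3)) (s : Bool) :
    (is.map (letter · s)).map color = is := by
  simp [Function.comp_def, color_letter]

theorem level_orbits_eq (n : ℕ) :
    {O : Set (List (Fin 6)) | ∃ w : List (Fin 6), w.length = n ∧ O = MulAction.orbit U w} =
      {O | ∃ is : List (Fin 3), is.length = n ∧ O = wordProduct is} := by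
  ext O
  constructor
  · rintro ⟨w, hw, rfl⟩
    exact ⟨w.map color, by simpa using hw, orbit_eq_wordProduct w⟩
  · rintro ⟨is, his, rfl⟩
    refine ⟨is.map (letter · true), by simpa using his, ?_⟩
    rw [orbit_eq_wordProduct, map_color_map_letter]

/-! ### The orbit tree -/

/-- The orbits on the vertices correspond to the words over the three colours. -/
def orbitEquiv : MulAction.orbitRel.Quotient U (List (Fin 6)) ≃ List (Fin 3) where
  toFun := Quotient.lift (List.map color) fun _ _ h => mem_orbit_iff.1 h
  invFun is := Quotient.mk _ (is.map (letter · true))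
  left_inv := by
    rintro ⟨w⟩
    exact Quotient.sound (mem_orbit_iff.2 (map_color_map_letter _ _))
  right_inv is := map_color_map_letter is true

theorem mem_quotient_orbit_iff {w : List (Fin 6)}
    {O : MulAction.orbitRel.Quotient U (List (Fin 6))} :
    w ∈ O.orbit ↔ w.map color = orbitEquiv O := by
  induction O using Quotient.inductionOn with
  | h v => exact mem_orbit_iff

theorem exists_of_map_color_append {is : List (Fin 3)} {i : Fin 3} :
    ∃ u : List (Fin 6), ∃ x, u.map color = is ∧ (u ++ [x]).map color = is ++ [i] := by
  refine ⟨is.map (letter · true), letter i true, map_color_map_letter _ _, ?_⟩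
  rw [List.map_append, map_color_map_letter, List.map_singleton, color_letter]

theorem wordTree_adj_of_map {u v : List (Fin 6)} (h : (wordTree (Fin 6)).Adj u v) :
    (wordTree (Fin 3)).Adj (u.map color) (v.map color) := by
  rcases h with ⟨x, rfl⟩ | ⟨x, rfl⟩
  · exact Or.inl ⟨color x, by simp⟩
  · exact Or.inr ⟨color x, by simp⟩

/-- The orbit tree is the 3-regular rooted tree. -/
def orbitTreeIso : orbitTree U (wordTree (Fin 6)) ≃g wordTree (Fin 3) where
  toEquiv := orbitEquiv
  map_rel_iff' := by
    intro O O'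
    constructor
    · intro h
      refine ⟨fun e => (wordTree (Fin 3)).loopless.irrefl _ (e ▸ h), ?_⟩
      simp only [mem_quotient_orbit_iff]
      rcases h with ⟨i, h⟩ | ⟨i, h⟩
      · obtain ⟨u, x, hu, hx⟩ := exists_of_map_color_append (is := orbitEquiv O) (i := i)
        exact ⟨u, hu, u ++ [x], hx.trans h.symm, Or.inl ⟨x, rfl⟩⟩
      · obtain ⟨u, x, hu, hx⟩ := exists_of_map_color_append (is := orbitEquiv O') (i := i)
        exact ⟨u ++ [x], hx.trans h.symm, u, hu, Or.inr ⟨x, rfl⟩⟩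
    · rintro ⟨-, u, hu, v, hv, h⟩
      rw [mem_quotient_orbit_iff] at hu hv
      rw [← hu, ← hv]
      exact wordTree_adj_of_map h

theorem orbitTreeIso_root : orbitTreeIso (Quotient.mk _ ([] : List (Fin 6))) = [] := rfl

/-! ### Sequences over three letters and over two letters -/

/-- Decoding with the prefix code `0`, `10`, `11`: the first letter. -/
def decodeHead (s : ℕ → Bool) : Fin 3 := bif s 0 then (bif s 1 then 2 else 1) else 0

/-- Decoding with the prefix code `0`, `10`, `11`: what follows the first code word. -/
def decodeTail (s : ℕ → Bool) (n : ℕ) : Bool := bif s 0 then s (n + 2) else s (n + 1)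

/-- Decoding with the prefix code `0`, `10`, `11`. -/
def decode (s : ℕ → Bool) (n : ℕ) : Fin 3 := decodeHead (decodeTail^[n] s)

/-- Encoding with the prefix code `0`, `10`, `11`. -/
def encode : ℕ → (ℕ → Fin 3) → Bool
  | 0, t => decide (t 0 ≠ 0)
  | 1, t => if t 0 = 0 then encode 0 (fun n => t (n + 1)) else decide (t 0 = 2)
  | n + 2, t =>
    if t 0 = 0 then encode (n + 1) (fun n => t (n + 1)) else encode n (fun n => t (n + 1))

theorem decode_zero (s : ℕ → Bool) : decode s 0 = decodeHead s := rfl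

theorem decode_succ (s : ℕ → Bool) (n : ℕ) : decode s (n + 1) = decode (decodeTail s) n := rfl

/-- Strong induction is needed because removing the first code word shifts the index by one or by
two. -/
theorem encode_decode (n : ℕ) (s : ℕ → Bool) : encode n (decode s) = s n := by
  induction n using Nat.strong_induction_on generalizing s with
  | _ n ih =>
    match n with
    | 0 => cases h0 : s 0 <;> cases h1 : s 1 <;> simp [encode, decode_zero, decodeHead, h0, h1]
    | 1 =>
      have h : encode 1 (decode s) = if decodeHead s = 0 then encode 0 (decode (decodeTail s))
        else decide (decodeHead s = 2) := rfl
      rw [h, ih 0 (by omega)]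
      cases h0 : s 0 <;> cases h1 : s 1 <;> simp [decodeHead, decodeTail, h0, h1]
    | n + 2 =>
      have h := ih n (by omega) (decodeTail s)
      have h' := ih (n + 1) (by omega) (decodeTail s)
      cases h0 : s 0 <;> cases h1 : s 1 <;>
        simp only [encode, decode_zero, decode_succ, decodeHead, h0, h1, h, h'] <;>
        simp [decodeTail, h0]

theorem decodeHead_encode (t : ℕ → Fin 3) : decodeHead (fun n => encode n t) = t 0 := by
  simp only [decodeHead, encode]
  generalize t 0 = i
  fin_cases i <;> simp

theorem decodeTail_encode (t : ℕ → Fin 3) :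
    decodeTail (fun n => encode n t) = fun n => encode n (fun k => t (k + 1)) := by
  funext n
  by_cases h : t 0 = 0
  · cases n <;> simp [decodeTail, encode, h]
  · simp [decodeTail, encode, h]

theorem decode_encode (n : ℕ) (t : ℕ → Fin 3) : decode (fun n => encode n t) n = t n := by
  induction n generalizing t with
  | zero => exact decodeHead_encode t
  | succ n ih => rw [decode_succ, decodeTail_encode, ih]

theorem continuous_decodeHead : Continuous decodeHead := by
  have h : Continuous fun s : ℕ → Bool => (s 0, s 1) := by fun_prop
  exact (continuous_of_discreteTopology (f := fun p : Bool × Bool =>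
    (bif p.1 then (bif p.2 then 2 else 1) else 0 : Fin 3))).comp h

theorem continuous_decodeTail : Continuous decodeTail := by
  refine continuous_pi fun n => ?_
  have h : Continuous fun s : ℕ → Bool => (s 0, s (n + 2), s (n + 1)) := by fun_prop
  exact (continuous_of_discreteTopology (f := fun p : Bool × Bool × Bool =>
    bif p.1 then p.2.1 else p.2.2)).comp h

/-- Decoding with a complete prefix code is a homeomorphism. -/
noncomputable def decodeHomeomorph : (ℕ → Bool) ≃ₜ (ℕ → Fin 3) :=
  Continuous.homeoOfEquivCompactToT2
    (f := { toFun := decode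
            invFun := fun t n => encode n t
            left_inv := fun s => funext fun n => encode_decode n s
            right_inv := fun t => funext fun n => decode_encode n t })
    (continuous_pi fun n => continuous_decodeHead.comp (continuous_decodeTail.iterate n))

/-! ### The boundary of a rooted tree -/

section Boundary

variable {V : Type*} {T : SimpleGraph V} {r : V}

theorem continuous_vertex (n : ℕ) :
    @Continuous (Boundary T r) V _ ⊥ (fun ξ => ξ.vertex n) := by
  let : TopologicalSpace V := ⊥
  exact (continuous_apply n).comp (continuous_induced_dom (f := Boundary.vertex))

theorem isOpen_vertex_mem (n : ℕ) (A : Set V) : IsOpen {ξ : Boundary T r | ξ.vertex n ∈ A} := by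
  let : TopologicalSpace V := ⊥
  have : DiscreteTopology V := ⟨rfl⟩
  exact (isOpen_discrete A).preimage (continuous_vertex n)

theorem measurableSet_vertex_mem (n : ℕ) (A : Set V) :
    MeasurableSet {ξ : Boundary T r | ξ.vertex n ∈ A} :=
  (isOpen_vertex_mem n A).measurableSet

theorem measurableSet_cylinder (n : ℕ) (v : V) :
    MeasurableSet {ξ : Boundary T r | ξ.vertex n = v} :=
  measurableSet_vertex_mem n {v}

theorem continuous_of_continuous_vertex {X : Type*} [TopologicalSpace X] {f : X → Boundary T r}
    (h : ∀ n, @Continuous X V _ ⊥ fun x => (f x).vertex n) : Continuous f := by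
  let : TopologicalSpace V := ⊥
  exact continuous_induced_rng.2 (continuous_pi h)

/-- Makes the cylinders a subbasis, so that in the second countable case they generate the Borel
sets. -/
theorem boundaryTopology_eq_generateFrom :
    boundaryTopology T r = TopologicalSpace.generateFrom
      {A | ∃ n v, A = {ξ : Boundary T r | ξ.vertex n = v}} := by
  refine le_antisymm (le_generateFrom ?_) ?_
  · rintro _ ⟨n, v, rfl⟩
    exact isOpen_vertex_mem n {v}
  · let : TopologicalSpace V := ⊥
    have : DiscreteTopology V := ⟨rfl⟩
    refine continuous_iff_le_induced.1 ?_
    let := TopologicalSpace.generateFrom {A | ∃ n v, A = {ξ : Boundary T r | ξ.vertex n = v}}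
    refine continuous_pi fun n => continuous_discrete_rng.2 fun v => ?_
    exact TopologicalSpace.isOpen_generateFrom_of_mem ⟨n, v, rfl⟩

instance boundaryT2Space : T2Space (Boundary T r) := by
  let : TopologicalSpace V := ⊥
  have : DiscreteTopology V := ⟨rfl⟩
  exact T2Space.of_injective_continuous (f := Boundary.vertex (T := T) (r := r))
    (fun ξ η h => Boundary.ext h) continuous_induced_dom

instance boundaryContinuousConstSMul :
    ContinuousConstSMul (rootedAut T r) (Boundary T r) where
  continuous_const_smul g := by
    refine continuous_of_continuous_vertex fun n => ?_
    let : TopologicalSpace V := ⊥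
    have : DiscreteTopology V := ⟨rfl⟩
    exact (continuous_of_discreteTopology (f := fun v : V => g.1 v)).comp (continuous_vertex n)

end Boundary

section WordBoundary

variable {S : Type*}

/-- The root has no parent, and after a step away from the root, a step to the unique parent would
be backtracking; so the path always descends. -/
theorem exists_vertex_succ (ξ : Boundary (wordTree S) []) (n : ℕ) :
    ∃ x, ξ.vertex (n + 1) = ξ.vertex n ++ [x] := by
  induction n with
  | zero =>
    rcases ξ.adj 0 with h | ⟨x, h⟩
    · exact h
    · rw [ξ.vertex_zero] at h
      simp at h
  | succ n ih =>
    obtain ⟨y, hy⟩ := ih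
    rcases ξ.adj (n + 1) with h | ⟨x, h⟩
    · exact h
    · exact absurd (List.append_inj_left' (h.symm.trans hy) rfl) (ξ.no_backtrack n)

theorem length_vertex (ξ : Boundary (wordTree S) []) (n : ℕ) : (ξ.vertex n).length = n := by
  induction n with
  | zero => rw [ξ.vertex_zero]; rfl
  | succ n ih =>
    obtain ⟨x, hx⟩ := exists_vertex_succ ξ n
    rw [hx, List.length_append, ih]; rfl

theorem vertex_eq_take (ξ : Boundary (wordTree S) []) {m n : ℕ} (h : m ≤ n) :
    ξ.vertex m = (ξ.vertex n).take m := by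
  induction n, h using Nat.le_induction with
  | base => rw [List.take_of_length_le (length_vertex ξ m).le]
  | succ n h ih =>
    obtain ⟨x, hx⟩ := exists_vertex_succ ξ n
    rw [hx, List.take_append_of_le_length (by rwa [length_vertex]), ih]

/-- The boundary point given by an infinite word. -/
def ofLetters (x : ℕ → S) : Boundary (wordTree S) [] where
  vertex n := (List.range n).map x
  vertex_zero := rfl
  adj n := Or.inl ⟨x n, by rw [List.range_succ, List.map_append]; rfl⟩
  no_backtrack n h := by simpa using congrArg List.length h

theorem ofLetters_vertex_succ (x : ℕ → S) (n : ℕ) :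
    (ofLetters x).vertex (n + 1) = (ofLetters x).vertex n ++ [x n] := by
  simp [ofLetters, List.range_succ]

theorem ofLetters_injective : Function.Injective (ofLetters (S := S)) := by
  intro x y h
  funext n
  have h1 := ofLetters_vertex_succ x n
  rw [h, ofLetters_vertex_succ] at h1
  simpa using (List.append_inj_right' h1 rfl).symm

theorem ofLetters_surjective : Function.Surjective (ofLetters (S := S)) := by
  intro ξ
  choose x hx using exists_vertex_succ ξ
  refine ⟨x, Boundary.ext (funext fun n => ?_)⟩
  induction n with
  | zero => exact ξ.vertex_zero.symm
  | succ n ih => rw [ofLetters_vertex_succ, ih, hx]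

theorem continuous_ofLetters [TopologicalSpace S] [DiscreteTopology S] :
    Continuous (ofLetters (S := S)) := by
  refine continuous_of_continuous_vertex fun n => ?_
  let : TopologicalSpace (List S) := ⊥
  have : DiscreteTopology (List S) := ⟨rfl⟩
  induction n with
  | zero => exact continuous_const
  | succ n ih =>
    simp only [ofLetters_vertex_succ]
    exact (continuous_of_discreteTopology (f := fun p : List S × S => p.1 ++ [p.2])).comp
      (ih.prodMk (continuous_apply n))

/-- The boundary of the tree of words is the space of infinite words. -/
noncomputable def lettersHomeomorph [TopologicalSpace S] [DiscreteTopology S] [Finite S] :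
    (ℕ → S) ≃ₜ Boundary (wordTree S) [] :=
  Continuous.homeoOfEquivCompactToT2
    (f := Equiv.ofBijective ofLetters ⟨ofLetters_injective, ofLetters_surjective⟩)
    continuous_ofLetters

instance wordBoundarySecondCountable [Finite S] :
    SecondCountableTopology (Boundary (wordTree S) []) := by
  let : TopologicalSpace S := ⊥
  have : DiscreteTopology S := ⟨rfl⟩
  exact (lettersHomeomorph (S := S)).symm.isEmbedding.secondCountableTopology

instance wordBoundaryMetrizable [Finite S] :
    TopologicalSpace.MetrizableSpace (Boundary (wordTree S) []) := by
  let : TopologicalSpace S := ⊥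
  have : DiscreteTopology S := ⟨rfl⟩
  exact (lettersHomeomorph (S := S)).symm.isEmbedding.metrizableSpace

/-- Borel probability measures on the boundary are determined by the measures of the cylinders. -/
theorem measure_ext_of_cylinders [Finite S] {μ ν : Measure (Boundary (wordTree S) [])}
    [IsProbabilityMeasure μ] [IsProbabilityMeasure ν]
    (h : ∀ v : List S, μ {ξ | ξ.vertex v.length = v} = ν {ξ | ξ.vertex v.length = v}) : μ = ν := by
  refine ext_of_generate_finite {A | ∃ n v, A = {ξ | ξ.vertex n = v}}
    (borel_eq_generateFrom_of_subbasis boundaryTopology_eq_generateFrom) ?_ ?_ ?_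
  -- Cylinders form a π-system: if two of them share a point `ξ`, the deeper one is contained in the
  -- other.
  · rintro _ ⟨n, v, rfl⟩ _ ⟨m, w, rfl⟩ ⟨ξ, rfl, rfl⟩
    rcases le_total n m with hnm | hnm
    · refine ⟨m, ξ.vertex m, ?_⟩
      ext η
      simp only [Set.mem_inter_iff, Set.mem_ofPred_eq, and_iff_right_iff_imp]
      intro hη
      rw [vertex_eq_take η hnm, vertex_eq_take ξ hnm, hη]
    · refine ⟨n, ξ.vertex n, ?_⟩
      ext η
      simp only [Set.mem_inter_iff, Set.mem_ofPred_eq, and_iff_left_iff_imp]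
      intro hη
      rw [vertex_eq_take η hnm, vertex_eq_take ξ hnm, hη]
  · rintro _ ⟨n, v, rfl⟩
    by_cases hn : v.length = n
    · subst hn
      exact h v
    · have h0 : {ξ : Boundary (wordTree S) [] | ξ.vertex n = v} = ∅ := by
        refine Set.eq_empty_of_forall_notMem fun ξ hξ => hn ?_
        rw [← show ξ.vertex n = v from hξ, length_vertex]
      rw [h0, measure_empty, measure_empty]
  · rw [measure_univ, measure_univ]

end WordBoundary

/-! ### Invariant measures -/

local notation "𝒳" => Boundary (wordTree (Fin 6)) []

theorem vertex_smul (g : U) (ξ : 𝒳) (n : ℕ) : (g • ξ).vertex n = g • ξ.vertex n := rfl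

theorem measurable_smul_boundary (g : U) : Measurable fun ξ : 𝒳 => g • ξ :=
  (continuous_const_smul (g : rootedAut (wordTree (Fin 6)) [])).measurable

theorem preimage_smul_cylinder (g : U) (n : ℕ) (v : List (Fin 6)) :
    (fun ξ : 𝒳 => g • ξ) ⁻¹' {ξ | ξ.vertex n = v} = {ξ | ξ.vertex n = g⁻¹ • v} := by
  ext ξ
  simp only [Set.mem_preimage, Set.mem_ofPred_eq, vertex_smul]
  exact eq_inv_smul_iff.symm

/-- A measure is invariant as soon as the measure of a cylinder depends only on its colours. -/
theorem smulInvariantMeasure_of_cylinders {μ : Measure 𝒳} [IsProbabilityMeasure μ]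
    (h : ∀ v w : List (Fin 6), v.map color = w.map color →
      μ {ξ | ξ.vertex v.length = v} = μ {ξ | ξ.vertex w.length = w}) :
    SMulInvariantMeasure U 𝒳 μ := by
  refine ⟨fun g A hA => ?_⟩
  have : IsProbabilityMeasure (μ.map fun ξ => g • ξ) :=
    Measure.isProbabilityMeasure_map (measurable_smul_boundary g).aemeasurable
  have hμ : μ.map (fun ξ => g • ξ) = μ := by
    refine measure_ext_of_cylinders fun v => ?_
    rw [Measure.map_apply (measurable_smul_boundary g) (measurableSet_cylinder _ v),
      preimage_smul_cylinder, ← h _ v (map_color_smul g⁻¹ v), length_smul]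
  rw [← Measure.map_apply (measurable_smul_boundary g) hA, hμ]

/-- In an invariant measure the measure of a cylinder depends only on its colours. -/
theorem measure_cylinder_eq (μ : Measure 𝒳) [SMulInvariantMeasure U 𝒳 μ] {n : ℕ}
    {v w : List (Fin 6)} (h : v.map color = w.map color) :
    μ {ξ | ξ.vertex n = v} = μ {ξ | ξ.vertex n = w} := by
  obtain ⟨g, hg⟩ := exists_smul_eq_of_map_color_eq h.symm
  rw [← hg, ← inv_inv g, ← preimage_smul_cylinder, measure_preimage_smul]

/-- The words of a given colouring. -/
noncomputable def coloredWords (is : List (Fin 3)) : Finset (List (Fin 6)) :=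
  Set.Finite.toFinset (s := {w | w.map color = is})
    ((List.finite_length_eq (Fin 6) is.length).subset fun w hw => by
      rw [Set.mem_ofPred_eq] at hw ⊢
      rw [← hw, List.length_map])

theorem mem_coloredWords {is : List (Fin 3)} {w : List (Fin 6)} :
    w ∈ coloredWords is ↔ w.map color = is := by
  simp [coloredWords]

/-- The cylinders over the words of this colouring carry total mass one, and invariance makes their
masses equal. -/
theorem measure_cylinder_eq_inv_card {μ : Measure 𝒳} [IsProbabilityMeasure μ]
    [SMulInvariantMeasure U 𝒳 μ] {v : List (Fin 6)}
    (h : ∀ᵐ ξ ∂μ, (ξ.vertex v.length).map color = v.map color) :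
    μ {ξ | ξ.vertex v.length = v} = ((coloredWords (v.map color)).card : ENNReal)⁻¹ := by
  have h1 : ∑ w ∈ coloredWords (v.map color), μ ((fun ξ => ξ.vertex v.length) ⁻¹' {w}) = 1 := by
    rw [sum_measure_preimage_singleton _ fun w _ => measurableSet_cylinder _ w]
    have hm : MeasurableSet
        ((fun ξ : 𝒳 => ξ.vertex v.length) ⁻¹' ↑(coloredWords (v.map color))) :=
      measurableSet_vertex_mem _ _
    rw [← prob_compl_eq_zero_iff hm]
    refine measure_mono_null (fun ξ hξ => ?_) (ae_iff.1 h)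
    simpa [mem_coloredWords] using hξ
  have h2 (w) (hw : w ∈ coloredWords (v.map color)) :
      μ ((fun ξ => ξ.vertex v.length) ⁻¹' {w}) = μ {ξ | ξ.vertex v.length = v} :=
    measure_cylinder_eq μ (mem_coloredWords.1 hw)
  rw [Finset.sum_congr rfl h2, Finset.sum_const, nsmul_eq_mul, mul_comm] at h1
  exact ENNReal.eq_inv_of_mul_eq_one_left h1

/-- There is at most one invariant probability measure concentrated on the boundary points of a
given colouring. -/
theorem eq_of_ae_map_color_eq {μ ν : Measure 𝒳} [IsProbabilityMeasure μ]
    [IsProbabilityMeasure ν] [SMulInvariantMeasure U 𝒳 μ] [SMulInvariantMeasure U 𝒳 ν]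
    {ω : ℕ → Fin 3} (hμ : ∀ n, ∀ᵐ ξ ∂μ, (ξ.vertex n).map color = (List.range n).map ω)
    (hν : ∀ n, ∀ᵐ ξ ∂ν, (ξ.vertex n).map color = (List.range n).map ω) : μ = ν := by
  refine measure_ext_of_cylinders fun v => ?_
  by_cases hv : v.map color = (List.range v.length).map ω
  · rw [measure_cylinder_eq_inv_card (by simpa only [hv] using hμ v.length),
      measure_cylinder_eq_inv_card (by simpa only [hv] using hν v.length)]
  · have hzero : ∀ ρ : Measure 𝒳,
        (∀ᵐ ξ ∂ρ, (ξ.vertex v.length).map color = (List.range v.length).map ω) →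
          ρ {ξ | ξ.vertex v.length = v} = 0 := by
      intro ρ hρ
      refine measure_mono_null (fun ξ hξ => ?_) (ae_iff.1 hρ)
      rw [Set.mem_ofPred_eq] at hξ ⊢
      rwa [hξ]
    rw [hzero μ (hμ _), hzero ν (hν _)]

/-! ### The measure on the boundary points of a given colouring -/

/-- The uniform measure on two points. -/
noncomputable def coin : Measure Bool := (PMF.uniformOfFintype Bool).toMeasure

instance coinIsProbabilityMeasure : IsProbabilityMeasure coin :=
  inferInstanceAs (IsProbabilityMeasure (PMF.uniformOfFintype Bool).toMeasure)

theorem coin_singleton (s t : Bool) : coin {s} = coin {t} := by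
  simp [coin]

/-- Either the common colour is not `i` and both events are empty, or each event is a single coin
outcome. -/
theorem coin_letter_eq {x y : Fin 6} (h : color x = color y) (i : Fin 3) :
    coin {s | x = letter i s} = coin {s | y = letter i s} := by
  have key : ∀ x y : Fin 6, color x = color y →
      (∀ s, x ≠ letter i s) ∧ (∀ s, y ≠ letter i s) ∨
      ∃ s t, (∀ u, x = letter i u ↔ u = s) ∧ (∀ u, y = letter i u ↔ u = t) := by
    revert i; decide
  rcases key x y h with ⟨hx, hy⟩ | ⟨s, t, hx, hy⟩
  · simp [hx, hy]
  · simpa [hx, hy] using coin_singleton s t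

/-- The boundary point with the given colours and choices of letters. -/
def branch (ω : ℕ → Fin 3) (s : ℕ → Bool) : 𝒳 := ofLetters fun n => letter (ω n) (s n)

theorem continuous_branch :
    Continuous fun p : (ℕ → Fin 3) × (ℕ → Bool) => branch p.1 p.2 := by
  refine continuous_ofLetters.comp (continuous_pi fun n => ?_)
  have h : Continuous fun p : (ℕ → Fin 3) × (ℕ → Bool) => (p.1 n, p.2 n) := by fun_prop
  exact (continuous_of_discreteTopology (f := fun q : Fin 3 × Bool => letter q.1 q.2)).comp h

theorem measurable_branch (ω : ℕ → Fin 3) : Measurable (branch ω) :=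
  (continuous_branch.comp (Continuous.prodMk_right ω)).measurable

theorem map_color_branch (ω : ℕ → Fin 3) (s : ℕ → Bool) (n : ℕ) :
    ((branch ω s).vertex n).map color = (List.range n).map ω := by
  simp [branch, ofLetters, color_letter]

/-- The uniform measure on the boundary points of a given colouring. -/
noncomputable def branchMeasure (ω : ℕ → Fin 3) : ProbabilityMeasure 𝒳 :=
  ⟨(Measure.infinitePi fun _ => coin).map (branch ω),
    Measure.isProbabilityMeasure_map (measurable_branch ω).aemeasurable⟩

theorem branchMeasure_coe (ω : ℕ → Fin 3) :
    (branchMeasure ω : Measure 𝒳) = (Measure.infinitePi fun _ => coin).map (branch ω) := rfl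

/-- Exhibits the preimage of a cylinder as a box with one condition per coin, so that its product
measure factors. -/
theorem branch_mem_cylinder_iff {ω : ℕ → Fin 3} {s : ℕ → Bool} {v : List (Fin 6)} :
    (branch ω s).vertex v.length = v ↔
      ∀ k < v.length, v[k]? = some (letter (ω k) (s k)) := by
  constructor
  · intro h k hk
    rw [← h]
    simp [branch, ofLetters, hk]
  · intro h
    refine List.ext_getElem? fun k => ?_
    by_cases hk : k < v.length
    · rw [h k hk]
      simp [branch, ofLetters, hk]
    · rw [List.getElem?_eq_none (by simpa [length_vertex] using hk),
        List.getElem?_eq_none (by simpa using hk)]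

theorem branchMeasure_cylinder (ω : ℕ → Fin 3) (v : List (Fin 6)) :
    (branchMeasure ω : Measure 𝒳) {ξ | ξ.vertex v.length = v} =
      ∏ k ∈ Finset.range v.length, coin {s | v[k]? = some (letter (ω k) s)} := by
  rw [branchMeasure_coe, Measure.map_apply (measurable_branch ω) (measurableSet_cylinder _ v),
    ← Measure.infinitePi_pi (fun _ => coin) fun _ _ => MeasurableSet.of_discrete]
  congr 1
  ext s
  simp [branch_mem_cylinder_iff, Set.mem_pi]

instance branchMeasureInvariant (ω : ℕ → Fin 3) :
    SMulInvariantMeasure U 𝒳 (branchMeasure ω : Measure 𝒳) := by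
  refine smulInvariantMeasure_of_cylinders fun v w h => ?_
  have hl : v.length = w.length := by simpa using congrArg List.length h
  rw [branchMeasure_cylinder, branchMeasure_cylinder, hl]
  refine Finset.prod_congr rfl fun k hk => ?_
  have hk' : k < w.length := Finset.mem_range.1 hk
  have hc := congrArg (·[k]?) h
  simp only [List.getElem?_map, List.getElem?_eq_getElem hk',
    List.getElem?_eq_getElem (hl ▸ hk' : k < v.length), Option.map_some, Option.some.injEq]
    at hc ⊢
  exact coin_letter_eq hc _

theorem ae_map_color_branchMeasure (ω : ℕ → Fin 3) (n : ℕ) :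
    ∀ᵐ ξ ∂(branchMeasure ω : Measure 𝒳), (ξ.vertex n).map color = (List.range n).map ω := by
  have hm : MeasurableSet {ξ : 𝒳 | (ξ.vertex n).map color = (List.range n).map ω} :=
    measurableSet_vertex_mem n {w : List (Fin 6) | w.map color = (List.range n).map ω}
  rw [branchMeasure_coe, ae_map_iff (measurable_branch ω).aemeasurable hm]
  exact Filter.Eventually.of_forall fun s => map_color_branch ω s n

/-- All these measures are images of one coin measure, so `ω` enters only through the integrand, and
dominated convergence applies. -/
theorem continuous_branchMeasure : Continuous branchMeasure := by
  rw [ProbabilityMeasure.continuous_iff_forall_continuous_integral]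
  intro f
  have h : ∀ ω, ∫ ξ, f ξ ∂(branchMeasure ω : Measure 𝒳) =
      ∫ s, f (branch ω s) ∂(Measure.infinitePi fun _ => coin) := fun ω => by
    rw [branchMeasure_coe, integral_map (measurable_branch ω).aemeasurable
      f.continuous.aestronglyMeasurable]
  simp only [h]
  refine continuous_of_dominated (bound := fun _ => ‖f‖) (fun ω => ?_)
    (fun ω => Filter.Eventually.of_forall fun s => f.norm_coe_le_norm _) (integrable_const _)
    (Filter.Eventually.of_forall fun s => ?_)
  · exact (f.continuous.measurable.comp (measurable_branch ω)).aestronglyMeasurable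
  · exact f.continuous.comp (continuous_branch.comp (Continuous.prodMk_left s))

theorem branchMeasure_injective : Function.Injective branchMeasure := by
  intro ω ω' h
  have h1 := ae_map_color_branchMeasure ω
  rw [h] at h1
  funext n
  -- Two full-measure events share a point, whose first `n + 1` colours follow both `ω` and `ω'`.
  obtain ⟨ξ, hξ, hξ'⟩ := ((h1 (n + 1)).and (ae_map_color_branchMeasure ω' (n + 1))).exists
  have h2 := hξ.symm.trans hξ'
  rw [List.map_inj_left] at h2
  exact h2 n (List.mem_range.2 n.lt_succ_self)

/-- Conditioning on an invariant set of positive measure gives an invariant measure with the same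
colours. By uniqueness it is the original measure, so the complement of the set is null. -/
theorem branchMeasure_mem_ergodicMeasures (ω : ℕ → Fin 3) :
    branchMeasure ω ∈ ergodicMeasures U 𝒳 := by
  refine ⟨inferInstance, fun A hA hinv => or_iff_not_imp_left.2 fun h0 => ?_⟩
  set μ : Measure 𝒳 := (branchMeasure ω : Measure 𝒳) with hμ
  have : IsProbabilityMeasure (ProbabilityTheory.cond μ A) :=
    ProbabilityTheory.cond_isProbabilityMeasure h0
  have : SMulInvariantMeasure U 𝒳 (ProbabilityTheory.cond μ A) := by
    refine ⟨fun g B _ => ?_⟩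
    rw [ProbabilityTheory.cond_apply hA, ProbabilityTheory.cond_apply hA]
    have h : (fun ξ => g • ξ) ⁻¹' (A ∩ B) = A ∩ (fun ξ => g • ξ) ⁻¹' B := by
      rw [Set.preimage_inter, hinv]
    rw [← h, measure_preimage_smul]
  have h : ProbabilityTheory.cond μ A = μ :=
    eq_of_ae_map_color_eq (ω := ω)
      (fun n => ProbabilityTheory.cond_absolutelyContinuous.ae_le
        (ae_map_color_branchMeasure ω n))
      (ae_map_color_branchMeasure ω)
  rw [← prob_compl_eq_zero_iff hA, ← h, ProbabilityTheory.cond_apply hA, Set.inter_compl_self,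
    measure_empty, mul_zero]

/-- Under an ergodic measure the colour of each letter is constant almost everywhere. -/
theorem exists_ae_color_eq {μ : ProbabilityMeasure 𝒳} (hμ : μ ∈ ergodicMeasures U 𝒳) (n : ℕ) :
    ∃ i, ∀ᵐ ξ ∂(μ : Measure 𝒳), ((ξ.vertex (n + 1)).map color).getLast? = some i := by
  have hmeas (i : Fin 3) :
      MeasurableSet {ξ : 𝒳 | ((ξ.vertex (n + 1)).map color).getLast? = some i} :=
    measurableSet_vertex_mem (n + 1) {w : List (Fin 6) | (w.map color).getLast? = some i}
  have hor (i : Fin 3) := hμ.2 {ξ : 𝒳 | ((ξ.vertex (n + 1)).map color).getLast? = some i}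
    (hmeas i) fun g => by
      ext ξ
      simp only [Set.mem_preimage, Set.mem_ofPred_eq, vertex_smul, map_color_smul]
  by_contra hne
  rw [not_exists] at hne
  -- If no colour had full measure, all three colour events would be null, yet they cover the
  -- boundary.
  have hzero (i : Fin 3) := (hor i).resolve_right fun h => hne i (by
    rwa [← prob_compl_eq_zero_iff (hmeas i)] at h)
  have huniv := measure_iUnion_null hzero
  have hU : (⋃ i : Fin 3, {ξ : 𝒳 | ((ξ.vertex (n + 1)).map color).getLast? = some i}) =
      Set.univ := by
    refine Set.eq_univ_of_forall fun ξ => ?_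
    obtain ⟨x, hx⟩ := exists_vertex_succ ξ n
    exact Set.mem_iUnion.2 ⟨color x, by simp [hx]⟩
  rw [hU, measure_univ] at huniv
  exact one_ne_zero huniv

/-- The almost sure colours of the individual letters assemble into a sequence `ω`, and uniqueness
for that `ω` identifies `μ`. -/
theorem exists_branchMeasure_eq {μ : ProbabilityMeasure 𝒳} (hμ : μ ∈ ergodicMeasures U 𝒳) :
    ∃ ω, branchMeasure ω = μ := by
  choose ω hω using exists_ae_color_eq hμ
  have := hμ.1
  suffices h : (branchMeasure ω : Measure 𝒳) = μ from ⟨ω, Subtype.ext h⟩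
  refine eq_of_ae_map_color_eq (ae_map_color_branchMeasure ω) fun n => ?_
  filter_upwards [ae_all_iff.2 hω] with ξ hξ
  induction n with
  | zero => rw [ξ.vertex_zero]; rfl
  | succ n ih =>
    have h := hξ n
    obtain ⟨x, hx⟩ := exists_vertex_succ ξ n
    rw [hx, List.map_append, List.map_singleton, List.getLast?_concat, Option.some.injEq] at h
    rw [hx, List.map_append, ih, List.range_succ, List.map_append, List.map_singleton,
      List.map_singleton, h]

/-- The space of ergodic invariant measures is the space of colourings. -/
noncomputable def ergodicMeasuresHomeomorph : (ℕ → Fin 3) ≃ₜ ergodicMeasures U 𝒳 :=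
  Continuous.homeoOfEquivCompactToT2
    (f := Equiv.ofBijective (fun ω => ⟨branchMeasure ω, branchMeasure_mem_ergodicMeasures ω⟩)
      ⟨fun _ _ h => branchMeasure_injective (congrArg Subtype.val h), fun μ =>
        (exists_branchMeasure_eq μ.2).imp fun _ h => Subtype.ext h⟩)
    (continuous_branchMeasure.subtype_mk _)

end RootedTreeAction

theorem mainTheorem5 :
    -- the orbits on level `n` are exactly the products of `n` of the three subalphabets
    (∀ n : ℕ,
      {O : Set (List (Fin 6)) | ∃ w : List (Fin 6), w.length = n ∧
          O = MulAction.orbit RootedTreeAction.universalGrigorchukGroup w} =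
        {O : Set (List (Fin 6)) | ∃ is : List (Fin 3), is.length = n ∧
          O = RootedTreeAction.wordProduct is}) ∧
    -- the orbit tree is isomorphic, as a rooted tree, to the 3-regular rooted tree
    (∃ φ : RootedTreeAction.orbitTree RootedTreeAction.universalGrigorchukGroup
          (RootedTreeAction.wordTree (Fin 6)) ≃g RootedTreeAction.wordTree (Fin 3),
      φ (Quotient.mk _ ([] : List (Fin 6))) = []) ∧
    -- the space of ergodic invariant probability measures is a Cantor set
    Nonempty
      (RootedTreeAction.ergodicMeasures RootedTreeAction.universalGrigorchukGroup
          (RootedTreeAction.Boundary (RootedTreeAction.wordTree (Fin 6)) []) ≃ₜ cantorSet) :=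
  ⟨RootedTreeAction.level_orbits_eq,
    ⟨RootedTreeAction.orbitTreeIso, RootedTreeAction.orbitTreeIso_root⟩,
    ⟨RootedTreeAction.ergodicMeasuresHomeomorph.symm.trans
      (RootedTreeAction.decodeHomeomorph.symm.trans cantorSetHomeomorphNatToBool.symm)⟩⟩
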